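/- Let $(\Omega,\mathcal B,\mu)$ be a $\sigma$-finite measure space with $\mu(\Omega)=\infty$, and let $T:\Omega\to\Omega$ be a measurable transformation which is - invertible: $T$ is bijective and $T^{-1}$ is measurable; - measure-preserving: $\mu(T^{-1}E)=\mu(E)$ for all $E\in\mathcal B$; - ergodic: if $E\in\mathcal B$ and $T^{-1}E=E$, then $\mu(E)=0$ or $\mu(\Omega\setminus E)=0$; - conservative: there is no $W\in\mathcal B$ with $\mu(W)>0$ such that the sets $T^{-n}W$, $n\ge 0$, are pairwise disjoint. For a function $f:\Omega\to\mathbb R$ and an integer $n\ge1$ write $$A_n(\omega,f,T)=\frac1n\sum_{k=0}^{n-1}f(T^k\omega).$$ Then there exist a $\mathcal B$-measurable function $f:\Omega\to\{0,1\}$ and two strictly increasing sequences $(p_k)$ and $(q_k)$ of positive integers such that, for $\mu$-a.e. $\omega\in\Omega$, $$\lim_{k\to\infty}A_{p_k}(\omega,f,T)=1\quad\text{and}\quad\lim_{k\to\infty}A_{q_k}(\omega,f,T)=0.$$ In particular, for $\mu$-a.e. $\omega\in\Omega$, $$\limsup_{n\to\infty}A_n(\omega,f,T)=1\quad\text{and}\quad\liminf_{n\to\infty}A_n(\omega,f,T)=0.$$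 -/

import Mathlib

open MeasureTheory Filter Topology

section MeanErgodic

variable {Ω : Type*} [MeasurableSpace Ω] {μ : Measure Ω}

/-! A set of finite measure is rarely visited: by von Neumann's theorem its averages tend to zero in
measure, since an ergodic map of an infinite measure space fixes no nonzero square integrable
function. Exhaust the space by sets `B k` of finite measure. At stage k, wait until a time q at
which the finite-measure set built so far has small averages, and protect the orbits of `B k` up to
q from this and later additions. The protected set again has finite measure, so at some p > q it is
rarely visited; adding the rest of the orbits up to p makes the averages at p close to 1 on most of
`B k`. Borel–Cantelli concludes. -/

theorem coeFn_birkhoffSum_compMeasurePreserving {S : Ω → Ω} (hS : MeasurePreserving S μ μ)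
    (g : Lp ℝ 2 μ) (n : ℕ) :
    (birkhoffSum (Lp.compMeasurePreserving S hS) id n g : Lp ℝ 2 μ) =ᵐ[μ] birkhoffSum S g n := by
  have iter : ∀ k : ℕ, ((Lp.compMeasurePreserving S hS)^[k] g : Lp ℝ 2 μ) =ᵐ[μ] g ∘ S^[k] := by
    intro k
    induction k with
    | zero => rfl
    | succ k ih =>
      rw [Function.iterate_succ_apply', Function.iterate_succ]
      exact (Lp.coeFn_compMeasurePreserving _ hS).trans
        (hS.quasiMeasurePreserving.ae_eq_comp ih)
  induction n with
  | zero =>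
    rw [birkhoffSum_zero, birkhoffSum_zero']
    exact Lp.coeFn_zero _ _ _
  | succ n ih =>
    rw [birkhoffSum_succ]
    filter_upwards [ih, iter n, Lp.coeFn_add (birkhoffSum (Lp.compMeasurePreserving S hS) id n g)
      (id ((Lp.compMeasurePreserving S hS)^[n] g))] with ω h₁ h₂ h₃
    rw [h₃, Pi.add_apply, h₁, birkhoffSum_succ, id, h₂, Function.comp]

theorem coeFn_birkhoffAverage_compMeasurePreserving {S : Ω → Ω} (hS : MeasurePreserving S μ μ)
    (g : Lp ℝ 2 μ) (n : ℕ) :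
    (birkhoffAverage ℝ (Lp.compMeasurePreserving S hS) id n g : Lp ℝ 2 μ) =ᵐ[μ]
      birkhoffAverage ℝ S g n := by
  filter_upwards [Lp.coeFn_smul (n : ℝ)⁻¹ (birkhoffSum (Lp.compMeasurePreserving S hS) id n g),
    coeFn_birkhoffSum_compMeasurePreserving hS g n] with ω h₁ h₂
  rw [birkhoffAverage, h₁, Pi.smul_apply, h₂, birkhoffAverage]

/-- Ergodicity makes an invariant function constant, and a nonzero constant is not square integrable
in infinite measure. -/
theorem Ergodic.eq_zero_of_compMeasurePreserving_eq {S : Ω → Ω} (hS : Ergodic S μ)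
    (hμ : μ Set.univ = ⊤) (g : Lp ℝ 2 μ)
    (hg : Lp.compMeasurePreserving S hS.toMeasurePreserving g = g) : g = 0 := by
  have hcomp : g ∘ S =ᵐ[μ] g := by
    have h := Lp.coeFn_compMeasurePreserving g hS.toMeasurePreserving
    rw [hg] at h
    exact h.symm
  obtain ⟨c, hc⟩ := hS.ae_eq_const_of_ae_eq_comp_ae (Lp.aestronglyMeasurable g) hcomp
  have hmem : MemLp (fun _ : Ω => c) 2 μ := (memLp_congr_ae hc).1 (Lp.memLp g)
  rcases (memLp_const_iff (by norm_num) (by norm_num)).1 hmem with h | h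
  · subst h
    exact (Lp.eq_zero_iff_ae_eq_zero).2 hc
  · exact absurd hμ h.ne

/-- In infinite measure, the averages of a square integrable function along an ergodic map
converge to zero in measure. -/
theorem Ergodic.tendstoInMeasure_birkhoffAverage {S : Ω → Ω} (hS : Ergodic S μ)
    (hμ : μ Set.univ = ⊤) {g : Ω → ℝ} (hg : MemLp g 2 μ) :
    TendstoInMeasure μ (birkhoffAverage ℝ S g) atTop 0 := by
  have hmp := hS.toMeasurePreserving
  let U : Lp ℝ 2 μ →L[ℝ] Lp ℝ 2 μ :=
    (Lp.compMeasurePreservingₗᵢ ℝ S hmp).toContinuousLinearMap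
  -- Mean ergodic theorem: the limit is the projection onto the fixed space, which is trivial here.
  have hlim := U.tendsto_birkhoffAverage_orthogonalProjection
    (LinearIsometry.norm_toContinuousLinearMap_le _) (hg.toLp g)
  have hzero : (((U.eqLocus (1 : Lp ℝ 2 μ →L[ℝ] Lp ℝ 2 μ)).orthogonalProjectionOnto
      (hg.toLp g) : U.eqLocus (1 : Lp ℝ 2 μ →L[ℝ] Lp ℝ 2 μ)) : Lp ℝ 2 μ) = 0 :=
    hS.eq_zero_of_compMeasurePreserving_eq hμ _ (LinearMap.mem_eqLocus.1 (Subtype.property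
      ((U.eqLocus (1 : Lp ℝ 2 μ →L[ℝ] Lp ℝ 2 μ)).orthogonalProjectionOnto (hg.toLp g))))
  rw [hzero] at hlim
  refine (tendstoInMeasure_of_tendsto_Lp hlim).congr (fun n => ?_) (Lp.coeFn_zero _ _ _)
  exact (coeFn_birkhoffAverage_compMeasurePreserving hmp (hg.toLp g) n).trans
    (hmp.quasiMeasurePreserving.birkhoffAverage_ae_eq_of_ae_eq ℝ hg.coeFn_toLp n)

theorem Ergodic.exists_measure_birkhoffAverage_indicator_le {S : Ω → Ω} (hS : Ergodic S μ)
    (hμ : μ Set.univ = ⊤) {E : Set Ω} (hE : MeasurableSet E) (hE' : μ E ≠ ⊤) (k N : ℕ) :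
    ∃ n, N < n ∧ μ {ω | (1 / (k + 1) : ℝ) ≤ birkhoffAverage ℝ S (E.indicator 1) n ω}
      ≤ (2⁻¹ : ENNReal) ^ k := by
  have h := hS.tendstoInMeasure_birkhoffAverage hμ (g := E.indicator 1)
    (memLp_indicator_const 2 hE (1 : ℝ) (Or.inr hE')) (ENNReal.ofReal (1 / (k + 1)))
    (ENNReal.ofReal_pos.2 (by positivity))
  have hpos : (0 : ENNReal) < 2⁻¹ ^ k := ENNReal.pow_pos (by simp) k
  obtain ⟨n, hn, hNn⟩ := ((h.eventually (ge_mem_nhds hpos)).and (eventually_gt_atTop N)).exists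
  refine ⟨n, hNn, (measure_mono fun ω hω => ?_).trans hn⟩
  simp only [Set.mem_ofPred_eq, Pi.zero_apply, edist_dist, Real.dist_eq, sub_zero] at hω ⊢
  exact ENNReal.ofReal_le_ofReal (hω.trans (le_abs_self _))

end MeanErgodic

section Orbit

variable {Ω : Type*} [MeasurableSpace Ω]

/-- The union of the images of `B` under the first `n` iterates of `T`. -/
def orbitSegment (T : Ω ≃ᵐ Ω) (B : Set Ω) (n : ℕ) : Set Ω :=
  ⋃ i ∈ Finset.range n, (T.symm : Ω → Ω)^[i] ⁻¹' B

theorem iterate_mem_orbitSegment (T : Ω ≃ᵐ Ω) {B : Set Ω} {n i : ℕ} (hi : i < n) {ω : Ω}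
    (hω : ω ∈ B) : (T : Ω → Ω)^[i] ω ∈ orbitSegment T B n := by
  refine Set.mem_biUnion (Finset.mem_coe.2 (Finset.mem_range.2 hi)) ?_
  rw [Set.mem_preimage, (Function.LeftInverse.iterate T.symm_apply_apply i) ω]
  exact hω

theorem measurableSet_orbitSegment (T : Ω ≃ᵐ Ω) {B : Set Ω} (hB : MeasurableSet B) (n : ℕ) :
    MeasurableSet (orbitSegment T B n) :=
  Finset.measurableSet_biUnion _ fun i _ => T.symm.measurable.iterate i hB

theorem measure_orbitSegment_ne_top {μ : Measure Ω} {T : Ω ≃ᵐ Ω}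
    (hT : MeasurePreserving (T : Ω → Ω) μ μ) {B : Set Ω} (hB : MeasurableSet B) (hB' : μ B ≠ ⊤)
    (n : ℕ) : μ (orbitSegment T B n) ≠ ⊤ := by
  refine ((measure_biUnion_lt_top (Finset.finite_toSet _)) fun i _ => ?_).ne
  rw [((hT.symm T).iterate i).measure_preimage hB.nullMeasurableSet]
  exact hB'.lt_top

end Orbit

section Average

variable {Ω : Type*} (S : Ω → Ω)

theorem birkhoffAverage_indicator_mono {E F : Set Ω} {n : ℕ} {ω : Ω}
    (h : ∀ i < n, S^[i] ω ∈ E → S^[i] ω ∈ F) :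
    (birkhoffAverage ℝ S (E.indicator 1) n ω : ℝ) ≤ birkhoffAverage ℝ S (F.indicator 1) n ω := by
  refine mul_le_mul_of_nonneg_left (Finset.sum_le_sum fun i hi => ?_) (by positivity)
  by_cases hE : S^[i] ω ∈ E
  · rw [Set.indicator_of_mem hE, Set.indicator_of_mem (h i (Finset.mem_range.1 hi) hE)]
  · rw [Set.indicator_of_notMem hE]
    exact Set.indicator_nonneg (fun _ _ => zero_le_one) _

theorem birkhoffAverage_indicator_nonneg (E : Set Ω) (n : ℕ) (ω : Ω) :
    (0 : ℝ) ≤ birkhoffAverage ℝ S (E.indicator 1) n ω :=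
  mul_nonneg (by positivity)
    (Finset.sum_nonneg fun _ _ => Set.indicator_nonneg (fun _ _ => zero_le_one) _)

theorem birkhoffAverage_indicator_add_compl (E : Set Ω) {n : ℕ} (hn : 0 < n) (ω : Ω) :
    birkhoffAverage ℝ S (E.indicator 1) n ω + birkhoffAverage ℝ S (Eᶜ.indicator 1) n ω
      = (1 : ℝ) := by
  have hn' : (n : ℝ) ≠ 0 := by positivity
  rw [← Pi.add_apply, ← Pi.add_apply, ← birkhoffAverage_add, Set.indicator_self_add_compl]
  simp [birkhoffAverage, birkhoffSum, hn']

theorem birkhoffAverage_indicator_le_one (E : Set Ω) (n : ℕ) (ω : Ω) :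
    birkhoffAverage ℝ S (E.indicator 1) n ω ≤ (1 : ℝ) := by
  rcases n.eq_zero_or_pos with rfl | hn
  · simp
  · linarith [birkhoffAverage_indicator_add_compl S E hn ω,
      birkhoffAverage_indicator_nonneg S Eᶜ n ω]

theorem limsup_eq_of_le_of_tendsto_comp {u : ℕ → ℝ} {a b : ℝ} (ha : ∀ n, a ≤ u n)
    (hb : ∀ n, u n ≤ b) {p : ℕ → ℕ} (hp : StrictMono p) (h : Tendsto (u ∘ p) atTop (𝓝 b)) :
    limsup u atTop = b := by
  have hbdd : IsBoundedUnder (· ≤ ·) atTop u := isBoundedUnder_of ⟨b, hb⟩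
  have hbdd' : IsBoundedUnder (· ≥ ·) atTop u := isBoundedUnder_of ⟨a, ha⟩
  refine le_antisymm (limsup_le_of_le hbdd'.isCoboundedUnder_le (Eventually.of_forall hb)) ?_
  refine le_of_forall_lt fun c hc => ?_
  obtain ⟨d, hcd, hdb⟩ := exists_between hc
  refine hcd.trans_le (le_limsup_of_frequently_le ?_ hbdd)
  exact hp.tendsto_atTop.frequently
    ((h.eventually (lt_mem_nhds hdb)).mono fun _ h => h.le).frequently

theorem liminf_eq_of_le_of_tendsto_comp {u : ℕ → ℝ} {a b : ℝ} (ha : ∀ n, a ≤ u n)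
    (hb : ∀ n, u n ≤ b) {p : ℕ → ℕ} (hp : StrictMono p) (h : Tendsto (u ∘ p) atTop (𝓝 a)) :
    liminf u atTop = a := by
  have hbdd : IsBoundedUnder (· ≤ ·) atTop u := isBoundedUnder_of ⟨b, hb⟩
  have hbdd' : IsBoundedUnder (· ≥ ·) atTop u := isBoundedUnder_of ⟨a, ha⟩
  refine le_antisymm ?_ (le_liminf_of_le hbdd.isCoboundedUnder_ge (Eventually.of_forall ha))
  refine le_of_forall_gt fun c hc => ?_
  obtain ⟨d, had, hdc⟩ := exists_between hc
  refine (liminf_le_of_frequently_le ?_ hbdd').trans_lt hdc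
  exact hp.tendsto_atTop.frequently
    ((h.eventually (gt_mem_nhds had)).mono fun _ h => h.le).frequently

end Average

section Construction

variable {Ω : Type*} [MeasurableSpace Ω] (T : Ω ≃ᵐ Ω) (φ : Set Ω → ℕ → ℕ → ℕ) (B : ℕ → Set Ω)

/-- Recursive construction: given a set `F` and a time `N`, a time `q > N` at which the averages
of `F` are small is followed by a time `p > q` at which the averages of the set
`orbitSegment T (B k) q` are small, and the rest of `orbitSegment T (B k) p` is added to `F`. -/
def alternatingStage : ℕ → Set Ω × ℕ
  | 0 => (∅, 0)
  | k + 1 =>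
    let s := alternatingStage k
    let C := orbitSegment T (B k) (φ s.1 k s.2)
    let p := φ C k (φ s.1 k s.2)
    (s.1 ∪ (orbitSegment T (B k) p \ C), p)

/-- The times at which averages are close to zero. -/
def lowTime (k : ℕ) : ℕ := φ (alternatingStage T φ B k).1 k (alternatingStage T φ B k).2

/-- The times at which averages are close to one. -/
def highTime (k : ℕ) : ℕ := (alternatingStage T φ B (k + 1)).2

/-- The union of the sets built in the stages of the construction. -/
def alternatingSet : Set Ω := ⋃ k, (alternatingStage T φ B k).1

theorem alternatingStage_succ_fst (k : ℕ) : (alternatingStage T φ B (k + 1)).1 =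
    (alternatingStage T φ B k).1 ∪ (orbitSegment T (B k) (highTime T φ B k) \
      orbitSegment T (B k) (lowTime T φ B k)) := rfl

theorem highTime_eq (k : ℕ) : highTime T φ B k =
    φ (orbitSegment T (B k) (lowTime T φ B k)) k (lowTime T φ B k) := rfl

variable {T φ B}

theorem measurableSet_alternatingStage (hB : ∀ k, MeasurableSet (B k)) (k : ℕ) :
    MeasurableSet (alternatingStage T φ B k).1 := by
  induction k with
  | zero => exact MeasurableSet.empty
  | succ k ih =>
    rw [alternatingStage_succ_fst]
    exact ih.union ((measurableSet_orbitSegment T (hB k) _).diff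
      (measurableSet_orbitSegment T (hB k) _))

theorem measure_alternatingStage_ne_top {μ : Measure Ω} (hT : MeasurePreserving (T : Ω → Ω) μ μ)
    (hB : ∀ k, MeasurableSet (B k)) (hB' : ∀ k, μ (B k) ≠ ⊤) (k : ℕ) :
    μ (alternatingStage T φ B k).1 ≠ ⊤ := by
  induction k with
  | zero => simp [alternatingStage]
  | succ k ih =>
    rw [alternatingStage_succ_fst]
    exact measure_union_ne_top ih
      (measure_ne_top_of_subset Set.sdiff_subset (measure_orbitSegment_ne_top hT (hB k) (hB' k) _))

theorem lowTime_lt_highTime (hφ : ∀ E k N, N < φ E k N) (k : ℕ) :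
    lowTime T φ B k < highTime T φ B k := hφ _ _ _

theorem highTime_lt_lowTime_succ (hφ : ∀ E k N, N < φ E k N) (k : ℕ) :
    highTime T φ B k < lowTime T φ B (k + 1) := hφ _ _ _

theorem strictMono_lowTime (hφ : ∀ E k N, N < φ E k N) : StrictMono (lowTime T φ B) :=
  strictMono_nat_of_lt_succ fun k =>
    (lowTime_lt_highTime hφ k).trans (highTime_lt_lowTime_succ hφ k)

theorem strictMono_highTime (hφ : ∀ E k N, N < φ E k N) : StrictMono (highTime T φ B) :=
  strictMono_nat_of_lt_succ fun k =>
    (highTime_lt_lowTime_succ hφ k).trans (lowTime_lt_highTime hφ (k + 1))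

/-- Each stage m ≥ k adds only points outside the orbit segment of `B m` up to its low time, which
contains that of `B k`. -/
theorem iterate_mem_alternatingStage (hφ : ∀ E k N, N < φ E k N) (hB : Monotone B) {k i : ℕ}
    {ω : Ω} (hω : ω ∈ B k) (hi : i < lowTime T φ B k)
    (h : (T : Ω → Ω)^[i] ω ∈ alternatingSet T φ B) :
    (T : Ω → Ω)^[i] ω ∈ (alternatingStage T φ B k).1 := by
  have hmono : Monotone fun m => (alternatingStage T φ B m).1 :=
    monotone_nat_of_le_succ fun _ => Set.subset_union_left
  obtain ⟨m, hm⟩ := Set.mem_iUnion.1 h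
  rcases le_total m k with hmk | hkm
  · exact hmono hmk hm
  · induction m, hkm using Nat.le_induction with
    | base => exact hm
    | succ m hkm ih =>
      rcases hm with hm | hm
      · exact ih hm
      · exact absurd (iterate_mem_orbitSegment T
          (hi.trans_le ((strictMono_lowTime hφ).monotone hkm)) (hB hkm hω)) hm.2

theorem iterate_mem_orbitSegment_of_notMem {k i : ℕ} {ω : Ω} (hω : ω ∈ B k)
    (hi : i < highTime T φ B k) (h : (T : Ω → Ω)^[i] ω ∈ (alternatingSet T φ B)ᶜ) :
    (T : Ω → Ω)^[i] ω ∈ orbitSegment T (B k) (lowTime T φ B k) := by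
  by_contra hC
  exact h (Set.mem_iUnion.2 ⟨k + 1, Or.inr ⟨iterate_mem_orbitSegment T hi hω, hC⟩⟩)

end Construction

theorem mainTheorem1 {Ω : Type*} [MeasurableSpace Ω] (μ : Measure Ω) [SigmaFinite μ]
    (hμ : μ Set.univ = ⊤) (T : Ω ≃ᵐ Ω) (hT : Ergodic (T : Ω → Ω) μ)
    (hcons : Conservative (T : Ω → Ω) μ) :
    ∃ (f : Ω → ℝ) (p q : ℕ → ℕ),
      Measurable f ∧ (∀ ω, f ω = 0 ∨ f ω = 1) ∧
      StrictMono p ∧ (∀ k, 0 < p k) ∧ StrictMono q ∧ (∀ k, 0 < q k) ∧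
      (∀ᵐ ω ∂μ,
        Tendsto (fun k => birkhoffAverage ℝ (T : Ω → Ω) f (p k) ω) atTop (𝓝 1) ∧
        Tendsto (fun k => birkhoffAverage ℝ (T : Ω → Ω) f (q k) ω) atTop (𝓝 0)) ∧
      (∀ᵐ ω ∂μ,
        limsup (fun n => birkhoffAverage ℝ (T : Ω → Ω) f n ω) atTop = 1 ∧
        liminf (fun n => birkhoffAverage ℝ (T : Ω → Ω) f n ω) atTop = 0) := by
  have hex : ∀ (E : Set Ω) (k N : ℕ), ∃ n, N < n ∧ (MeasurableSet E → μ E ≠ ⊤ →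
      μ {ω | (1 / (k + 1) : ℝ) ≤ birkhoffAverage ℝ T (E.indicator 1) n ω}
        ≤ (2⁻¹ : ENNReal) ^ k) := by
    intro E k N
    by_cases h : MeasurableSet E ∧ μ E ≠ ⊤
    · obtain ⟨n, hn, hn'⟩ := hT.exists_measure_birkhoffAverage_indicator_le hμ h.1 h.2 k N
      exact ⟨n, hn, fun _ _ => hn'⟩
    -- A junk value keeps `φ` total, so the recursion need not carry proofs of measurability and
    -- finiteness.
    · exact ⟨N + 1, N.lt_succ_self, fun h₁ h₂ => absurd ⟨h₁, h₂⟩ h⟩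
  choose φ hφ hφ' using hex
  let B := spanningSets μ
  have hB := measurableSet_spanningSets μ
  have hB' : ∀ k, μ (B k) ≠ ⊤ := fun k => (measure_spanningSets_lt_top μ k).ne
  have hBmono : Monotone B := monotone_spanningSets μ
  let F := alternatingSet T φ B
  let p := highTime T φ B
  let q := lowTime T φ B
  have hp : StrictMono p := strictMono_highTime hφ
  have hq : StrictMono q := strictMono_lowTime hφ
  have hq0 : ∀ k, 0 < q k := fun k => (Nat.zero_le _).trans_lt (hφ _ _ _)
  have hp0 : ∀ k, 0 < p k := fun k => (hq0 k).trans (lowTime_lt_highTime hφ k)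
  have hsum : ∑' k : ℕ, (2⁻¹ : ENNReal) ^ k ≠ ⊤ := by
    rw [ENNReal.tsum_geometric, ENNReal.one_sub_inv_two]
    simp
  -- Borel–Cantelli: almost every point lies in only finitely many exceptional sets.
  have hlow := ae_eventually_notMem (ne_top_of_le_ne_top hsum (ENNReal.tsum_le_tsum fun k =>
    hφ' (alternatingStage T φ B k).1 k (alternatingStage T φ B k).2
      (measurableSet_alternatingStage hB k)
      (measure_alternatingStage_ne_top hT.toMeasurePreserving hB hB' k)))
  have hhigh := ae_eventually_notMem (ne_top_of_le_ne_top hsum (ENNReal.tsum_le_tsum fun k =>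
    hφ' (orbitSegment T (B k) (q k)) k (q k) (measurableSet_orbitSegment T (hB k) _)
      (measure_orbitSegment_ne_top hT.toMeasurePreserving (hB k) (hB' k) _)))
  have hmem : ∀ ω, ∀ᶠ k in atTop, ω ∈ B k := by
    intro ω
    have hω : ω ∈ ⋃ k, B k := by rw [iUnion_spanningSets μ]; trivial
    obtain ⟨m, hm⟩ := Set.mem_iUnion.1 hω
    exact (eventually_ge_atTop m).mono fun k hk => hBmono hk hm
  have hlim : ∀ᵐ ω ∂μ,
      Tendsto (fun k => birkhoffAverage ℝ (T : Ω → Ω) (F.indicator 1) (p k) ω) atTop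
        (𝓝 (1 : ℝ)) ∧
      Tendsto (fun k => birkhoffAverage ℝ (T : Ω → Ω) (F.indicator 1) (q k) ω) atTop
        (𝓝 (0 : ℝ)) := by
    filter_upwards [hlow, hhigh] with ω h₁ h₂
    constructor
    · have hlim₁ : Tendsto (fun k : ℕ => 1 - 1 / ((k : ℝ) + 1)) atTop (𝓝 1) := by
        simpa using (tendsto_one_div_add_atTop_nhds_zero_nat (𝕜 := ℝ)).const_sub 1
      refine tendsto_of_tendsto_of_tendsto_of_le_of_le' hlim₁ tendsto_const_nhds ?_
        (Eventually.of_forall fun k => birkhoffAverage_indicator_le_one _ _ _ _)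
      filter_upwards [h₂, hmem ω] with k hk hωk
      -- Before time `p k`, visits to the complement of `F` are visits to the protected segment,
      -- which are rare.
      have hle := birkhoffAverage_indicator_mono (T : Ω → Ω) (n := p k)
        fun i hi => iterate_mem_orbitSegment_of_notMem (T := T) (φ := φ) hωk hi
      have hlt := not_le.1 hk
      rw [← highTime_eq T φ B k] at hlt
      linarith [birkhoffAverage_indicator_add_compl (T : Ω → Ω) F (hp0 k) ω]
    · refine tendsto_of_tendsto_of_tendsto_of_le_of_le' tendsto_const_nhds
        tendsto_one_div_add_atTop_nhds_zero_nat
        (Eventually.of_forall fun k => birkhoffAverage_indicator_nonneg _ _ _ _) ?_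
      filter_upwards [h₁, hmem ω] with k hk hωk
      exact (birkhoffAverage_indicator_mono (T : Ω → Ω) fun i hi =>
        iterate_mem_alternatingStage hφ hBmono hωk hi).trans (not_le.1 hk).le
  refine ⟨F.indicator 1, p, q, measurable_one.indicator
    (MeasurableSet.iUnion (measurableSet_alternatingStage hB)), fun ω => ?_, hp, hp0, hq, hq0,
    hlim, hlim.mono fun ω hω => ⟨?_, ?_⟩⟩
  · by_cases h : ω ∈ F <;> simp [h]
  · exact limsup_eq_of_le_of_tendsto_comp
      (fun n => birkhoffAverage_indicator_nonneg (T : Ω → Ω) F n ω)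
      (fun n => birkhoffAverage_indicator_le_one (T : Ω → Ω) F n ω) hp hω.1
  · exact liminf_eq_of_le_of_tendsto_comp
      (fun n => birkhoffAverage_indicator_nonneg (T : Ω → Ω) F n ω)
      (fun n => birkhoffAverage_indicator_le_one (T : Ω → Ω) F n ω) hq hω.2
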